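/- Let $w\in\mathbf{R}_{++}^n$ and $K_0\ge 0$. For payoffs $\phi_1,\dots,\phi_m$ on $\mathbf{R}^n_+$ with prices $c\in\mathbf{R}^m$ and the target payoff $\psi(x)=(w^Tx-K_0)_+$, let $$p^{\sup}=\sup\{\mathbf{E}_\pi\psi(x)\;:\;\pi \text{ a probability distribution on } \mathbf{R}_+^n,\ \mathbf{E}_\pi\phi_j(x)=c_j,\ j=1,\dots,m\}$$ (the $\phi_j$ being $\pi$-integrable), call such a $\pi$ feasible, and let $$d^{\sup}=\inf\{\lambda^Tc+\lambda_0\;:\;\lambda\in\mathbf{R}^m,\ \lambda_0\in\mathbf{R},\ \lambda^T\phi(x)+\lambda_0\ge\psi(x)\ \text{for all } x\in\mathbf{R}^n_+\}.$$ Products of vectors are componentwise and $e$ is the vector of ones. **1. One forward and one option per asset.** Let $p,q,K\in\mathbf{R}^n_+$ with $0\le p_i<q_i\le p_i+K_i$ for all $i$, and let the constraints be $\mathbf{E}_\pi x_i=q_i$ and $\mathbf{E}_\pi(x_i-K_i)_+=p_i$, $i=1,\dots,n$. Then $p^{\sup}=d^{\sup}=D(p,q,K,K_0)$, where $$D(p,q,K,K_0):=\max_{0\le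 j\le n+1}\Big\{w^Tp+\sum_i w_i\min(q_i-p_i,\beta_jK_i)-\beta_jK_0\Big\},$$ $\beta_0=0$, $\beta_j=(q_j-p_j)/K_j$ for $1\le j\le n$, $\beta_{n+1}=1$. The function $$t\mapsto w^T\big((e-t)q+tp\big)+(w^T(tK)-K_0)_+$$ has a minimizer on $[0,1]^n$, and for every minimizer $t^*$, setting $\hat K=t^*K$ and $\hat p=(e-t^*)q+t^*p$, $$p^{\sup}=d^{\sup}=w^T\hat p+(w^T\hat K-K_0)_+ ,$$ and this number is also both the primal and the dual value of the problem whose only constraints are the synthetic single-option constraints $\mathbf{E}_\pi(x_i-\hat K_i)_+=\hat p_i$, $i=1,\dots,n$. Moreover: - if $w^TK\le K_0$, then $t^*=e$, $d^{\sup}=w^Tp$, and there is a sequence of finitely supported feasible distributions $\pi_k$ with $\mathbf{E}_{\pi_k}\psi(x)\to d^{\sup}$; - if $w^TK>K_0$, then there is a finitely supported feasible distribution $\pi$ with $\mathbf{E}_\pi\psi(x)=d^{\sup}$ (whether $p>0$ or $p_i=0$ for some $i$). **2. Two options per asset.** Let $K^1,K^2,p^1,p^2\in\mathbf{R}_+^n$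 with $K^1_i<K^2_i$ and $0\le p^2_i<p^1_i\le p^2_i+(K^2_i-K^1_i)$ for all $i$, and let the constraints be $\mathbf{E}_\pi(x_i-K^j_i)_+=p^j_i$, $i=1,\dots,n$, $j=1,2$ (no forward price is given). Then $p^{\sup}=d^{\sup}=D(p^2,p^1,K^2-K^1,K_0-w^TK^1)$. The function $t\mapsto w^T((e-t)p^1+tp^2)+(w^T((e-t)K^1+tK^2)-K_0)_+$ has a minimizer on $[0,1]^n$, and for every minimizer $t^*$, setting $\hat K=(e-t^*)K^1+t^*K^2$ and $\hat p=(e-t^*)p^1+t^*p^2$, one has $p^{\sup}=d^{\sup}=w^T\hat p+(w^T\hat K-K_0)_+$, which is also both the primal and the dual value of the problem with the constraints $\mathbf{E}_\pi(x_i-\hat K_i)_+=\hat p_i$ only. If $w^TK^2\le K_0$, then $t^*=e$, $d^{\sup}=w^Tp^2$, and some sequence of finitely supported feasible distributions $\pi_k$ satisfies $\mathbf{E}_{\pi_k}\psi(x)\to d^{\sup}$; if $w^TK^2>K_0$, some finitely supported feasible distribution attains $d^{\sup}$. -/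

import Mathlib

open MeasureTheory Filter Topology

namespace BasketBounds

/-- Payoff `(wᵀx - K)₊` of a basket call with weights `w` and strike `K`. -/
def basketPayoff {n : ℕ} (w : Fin n → ℝ) (K : ℝ) (x : Fin n → ℝ) : ℝ :=
  max ((∑ i, w i * x i) - K) 0

/-- Payoffs `(x_i - K_i)₊` of one call per asset. -/
def callPayoff {n : ℕ} (K : Fin n → ℝ) (i : Fin n) (x : Fin n → ℝ) : ℝ :=
  max (x i - K i) 0

/-- Payoffs `x_i` of the forwards. -/
def forwardPayoff {n : ℕ} (i : Fin n) (x : Fin n → ℝ) : ℝ :=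
  x i

/-- `π` is a probability distribution on the nonnegative orthant under which every payoff
`φ i` is integrable with price `c i`. -/
def IsFeasible {n : ℕ} {ι : Type} (φ : ι → (Fin n → ℝ) → ℝ) (c : ι → ℝ)
    (π : Measure (Fin n → ℝ)) : Prop :=
  IsProbabilityMeasure π ∧ (∀ᵐ x ∂π, ∀ i, 0 ≤ x i) ∧
    ∀ j, Integrable (φ j) π ∧ ∫ x, φ j x ∂π = c j

/-- Primal value: the supremum of the expectation of the nonnegative payoff `ψ` over all
feasible distributions (the expectation is a Lebesgue integral with values in `[0, ∞]`). -/
noncomputable def primalSup {n : ℕ} {ι : Type} (φ : ι → (Fin n → ℝ) → ℝ) (c : ι → ℝ)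
    (ψ : (Fin n → ℝ) → ℝ) : EReal :=
  ⨆ (π : Measure (Fin n → ℝ)) (_ : IsFeasible φ c π),
    ((∫⁻ x, ENNReal.ofReal (ψ x) ∂π : ENNReal) : EReal)

/-- The portfolio of `l j` units of the payoff `φ j` and `l₀` in cash dominates `ψ` on the
nonnegative orthant. -/
def Dominates {n : ℕ} {ι : Type} [Fintype ι] (φ : ι → (Fin n → ℝ) → ℝ)
    (ψ : (Fin n → ℝ) → ℝ) (l₀ : ℝ) (l : ι → ℝ) : Prop :=
  ∀ x : Fin n → ℝ, (∀ i, 0 ≤ x i) → ψ x ≤ (∑ j, l j * φ j x) + l₀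

/-- Dual value: the infimum of the prices of the dominating portfolios. -/
noncomputable def dualSup {n : ℕ} {ι : Type} [Fintype ι] (φ : ι → (Fin n → ℝ) → ℝ)
    (c : ι → ℝ) (ψ : (Fin n → ℝ) → ℝ) : EReal :=
  ⨅ (l₀ : ℝ) (l : ι → ℝ) (_ : Dominates φ ψ l₀ l), (((∑ j, l j * c j) + l₀ : ℝ) : EReal)

/-- The points `β_0 = 0`, `β_j = (q_j - p_j) / K_j` for `1 ≤ j ≤ n`, `β_{n+1} = 1`. -/
noncomputable def breakpoint {n : ℕ} (p q K : Fin n → ℝ) : Fin (n + 2) → ℝ :=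
  Fin.cons 0 (Fin.snoc (fun j => (q j - p j) / K j) 1)

/-- `max_{0 ≤ j ≤ n+1} wᵀp + ∑ i, w_i min (q_i - p_i, β_j K_i) - β_j K₀`. -/
noncomputable def closedForm {n : ℕ} (w p q K : Fin n → ℝ) (K₀ : ℝ) : ℝ :=
  Finset.univ.sup' Finset.univ_nonempty fun j : Fin (n + 2) =>
    (∑ i, w i * p i) + (∑ i, w i * min (q i - p i) (breakpoint p q K j * K i))
      - breakpoint p q K j * K₀

/-- `wᵀp + (wᵀK - K₀)₊`. -/
def singleOptionBound {n : ℕ} (w p K : Fin n → ℝ) (K₀ : ℝ) : ℝ :=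
  (∑ i, w i * p i) + max ((∑ i, w i * K i) - K₀) 0

/-- `(e - t) a + t b`, with componentwise products. -/
def mix {n : ℕ} (t a b : Fin n → ℝ) : Fin n → ℝ :=
  fun i => (1 - t i) * a i + t i * b i

/-- `t ∈ [0,1]ⁿ` minimizes over `[0,1]ⁿ` the single-option bound for the interpolated prices
`(e - t) a + t b` and the interpolated strikes `(e - t) A + t B`. -/
def IsOptimalMix {n : ℕ} (w a b A B : Fin n → ℝ) (K₀ : ℝ) (t : Fin n → ℝ) : Prop :=
  t ∈ Set.Icc (0 : Fin n → ℝ) 1 ∧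
    IsMinOn (fun s => singleOptionBound w (mix s a b) (mix s A B) K₀)
      (Set.Icc (0 : Fin n → ℝ) 1) t

/-- `π` is carried by a finite set. -/
def HasFiniteSupport {n : ℕ} (π : Measure (Fin n → ℝ)) : Prop :=
  ∃ S : Finset (Fin n → ℝ), π ((S : Set (Fin n → ℝ))ᶜ) = 0

end BasketBounds

open BasketBounds

/-! On the nonnegative orthant a forward is a call with strike `0`, so the first problem is the
second with `K₁ = 0`. For two calls per asset, three facts squeeze both values.

Upper bound: a call is convex in its strike, so holding `1 - t i` and `t i` of the two calls
dominates the call at the interpolated strike, and such calls plus the cash `(wᵀK - K₀)₊` dominate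
the basket call. Hence the dual value is at most F(t), the single-option bound, for every t in the
cube (`dualSup_two_options_le`).

Lower bound: all assets are driven monotonically by one uniform variable u. For 0 < β ≤ 1 the law
`scenarioLaw` meets every constraint, the synthetic ones included, and exercising the basket call
exactly when u ≤ β earns D(β) = `levelBound` (`levelBound_le_integral_scenarioLaw`).

Saddle point: writing s₊ as the maximum of βs over β in [0,1] gives a Lagrangian in (t, β) whose
maximum over β is F and whose minimum over t is D. So D ≤ F, and `exists_saddle` finds a breakpoint
and a mix where they agree. If that β is positive, its law attains the value. If `wᵀK₂ ≤ K₀`, the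
optimum is β = 0, where the bonus of mean `p₂` has no event left to live on, and the value is
approached as β decreases to 0. -/

namespace BasketBounds

variable {n : ℕ}

/-! ### Weak duality and invariance under changes of payoffs off the orthant. -/

section Duality

variable {ι : Type}

theorem IsFeasible.congr {φ φ' : ι → (Fin n → ℝ) → ℝ} {c : ι → ℝ} {π : Measure (Fin n → ℝ)}
    (h : ∀ j x, (∀ i, 0 ≤ x i) → φ j x = φ' j x) (hπ : IsFeasible φ c π) :
    IsFeasible φ' c π := by
  obtain ⟨h1, h2, h3⟩ := hπ
  refine ⟨h1, h2, fun j => ?_⟩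
  have hj : φ j =ᵐ[π] φ' j := by
    filter_upwards [h2] with x hx using h j x hx
  exact ⟨(h3 j).1.congr hj, (integral_congr_ae hj).symm.trans (h3 j).2⟩

theorem isFeasible_congr {φ φ' : ι → (Fin n → ℝ) → ℝ} {c : ι → ℝ} {π : Measure (Fin n → ℝ)}
    (h : ∀ j x, (∀ i, 0 ≤ x i) → φ j x = φ' j x) : IsFeasible φ c π ↔ IsFeasible φ' c π :=
  ⟨IsFeasible.congr h, IsFeasible.congr fun j x hx => (h j x hx).symm⟩

theorem primalSup_congr {φ φ' : ι → (Fin n → ℝ) → ℝ} {c : ι → ℝ} {ψ : (Fin n → ℝ) → ℝ}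
    (h : ∀ j x, (∀ i, 0 ≤ x i) → φ j x = φ' j x) : primalSup φ c ψ = primalSup φ' c ψ := by
  simp only [primalSup, isFeasible_congr h]

theorem dualSup_congr [Fintype ι] {φ φ' : ι → (Fin n → ℝ) → ℝ} {c : ι → ℝ}
    {ψ : (Fin n → ℝ) → ℝ}
    (h : ∀ j x, (∀ i, 0 ≤ x i) → φ j x = φ' j x) : dualSup φ c ψ = dualSup φ' c ψ := by
  have hd : ∀ l₀ l, Dominates φ ψ l₀ l ↔ Dominates φ' ψ l₀ l := by
    intro l₀ l
    refine forall₂_congr fun x hx => ?_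
    simp only [h _ x hx]
  simp only [dualSup, hd]

theorem primalSup_le_dualSup [Fintype ι] (φ : ι → (Fin n → ℝ) → ℝ) (c : ι → ℝ)
    {ψ : (Fin n → ℝ) → ℝ} (hψ : ∀ x, 0 ≤ ψ x) : primalSup φ c ψ ≤ dualSup φ c ψ := by
  refine iSup₂_le fun π hπ => le_iInf fun l₀ => le_iInf₂ fun l hl => ?_
  obtain ⟨hprob, hnn, hφ⟩ := hπ
  have hdom : ∀ᵐ x ∂π, ψ x ≤ (∑ j, l j * φ j x) + l₀ := by
    filter_upwards [hnn] with x hx using hl x hx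
  have hint : Integrable (fun x => (∑ j, l j * φ j x) + l₀) π :=
    (integrable_finsetSum _ fun j _ => (hφ j).1.const_mul (l j)).add (integrable_const _)
  have hval : ∫ x, (∑ j, l j * φ j x) + l₀ ∂π = (∑ j, l j * c j) + l₀ := by
    rw [integral_add (integrable_finsetSum _ fun j _ => (hφ j).1.const_mul (l j))
      (integrable_const _), integral_finsetSum _ fun j _ => (hφ j).1.const_mul (l j)]
    simp [integral_const_mul, (hφ _).2]
  have hpos : ∀ᵐ x ∂π, 0 ≤ (∑ j, l j * φ j x) + l₀ := by
    filter_upwards [hdom] with x hx using (hψ x).trans hx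
  have hle : ∫⁻ x, ENNReal.ofReal (ψ x) ∂π ≤ ENNReal.ofReal ((∑ j, l j * c j) + l₀) := by
    rw [← hval, ofReal_integral_eq_lintegral_ofReal hint hpos]
    exact lintegral_mono_ae (by filter_upwards [hdom] with x hx using ENNReal.ofReal_le_ofReal hx)
  -- Nonnegativity of the price matters: `ENNReal.ofReal` would truncate a negative one to 0.
  have h0 : 0 ≤ (∑ j, l j * c j) + l₀ := hval ▸ integral_nonneg_of_ae hpos
  calc ((∫⁻ x, ENNReal.ofReal (ψ x) ∂π : ENNReal) : EReal)
      ≤ ((ENNReal.ofReal ((∑ j, l j * c j) + l₀) : ENNReal) : EReal) :=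
        EReal.coe_ennreal_le_coe_ennreal_iff.2 hle
    _ = (((∑ j, l j * c j) + l₀ : ℝ) : EReal) := by
        rw [EReal.coe_ennreal_ofReal, max_eq_left h0]

theorem IsFeasible.integral_le_primalSup {φ : ι → (Fin n → ℝ) → ℝ} {c : ι → ℝ}
    {ψ : (Fin n → ℝ) → ℝ} (hψ : ∀ x, 0 ≤ ψ x) {π : Measure (Fin n → ℝ)}
    (hπ : IsFeasible φ c π) (hint : Integrable ψ π) :
    ((∫ x, ψ x ∂π : ℝ) : EReal) ≤ primalSup φ c ψ := by
  refine le_trans (le_of_eq ?_) (le_iSup₂ (f := fun (π : Measure (Fin n → ℝ))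
    (_ : IsFeasible φ c π) => ((∫⁻ x, ENNReal.ofReal (ψ x) ∂π : ENNReal) : EReal)) π hπ)
  rw [← ofReal_integral_eq_lintegral_ofReal hint (ae_of_all _ hψ), EReal.coe_ennreal_ofReal,
    max_eq_left (integral_nonneg hψ)]

theorem dualSup_le [Fintype ι] {φ : ι → (Fin n → ℝ) → ℝ} {c : ι → ℝ} {ψ : (Fin n → ℝ) → ℝ}
    {l₀ : ℝ} {l : ι → ℝ} (h : Dominates φ ψ l₀ l) :
    dualSup φ c ψ ≤ (((∑ j, l j * c j) + l₀ : ℝ) : EReal) :=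
  iInf_le_of_le l₀ (iInf₂_le_of_le l h le_rfl)

theorem basketPayoff_nonneg (w : Fin n → ℝ) (K₀ : ℝ) (x : Fin n → ℝ) :
    0 ≤ basketPayoff w K₀ x :=
  le_max_right _ _

end Duality

/-! ### Superreplication by calls. -/

section Dominating

variable {w : Fin n → ℝ}

theorem basketPayoff_le_sum_callPayoff (hw : ∀ i, 0 < w i) (K : Fin n → ℝ) (K₀ : ℝ)
    (x : Fin n → ℝ) :
    basketPayoff w K₀ x ≤ (∑ i, w i * callPayoff K i x) + max ((∑ i, w i * K i) - K₀) 0 := by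
  have h : ∑ i, w i * x i ≤ (∑ i, w i * callPayoff K i x) + ∑ i, w i * K i := by
    rw [← Finset.sum_add_distrib]
    refine Finset.sum_le_sum fun i _ => ?_
    have := le_max_left (x i - K i) 0
    have := mul_le_mul_of_nonneg_left this (hw i).le
    simp only [callPayoff]
    linarith
  have h0 : 0 ≤ ∑ i, w i * callPayoff K i x :=
    Finset.sum_nonneg fun i _ => mul_nonneg (hw i).le (le_max_right _ _)
  refine max_le ?_ (add_nonneg h0 (le_max_right _ _))
  linarith [le_max_left ((∑ i, w i * K i) - K₀) 0]

theorem callPayoff_mix_le {t : Fin n → ℝ} (ht : t ∈ Set.Icc (0 : Fin n → ℝ) 1)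
    (K₁ K₂ : Fin n → ℝ) (i : Fin n) (x : Fin n → ℝ) :
    callPayoff (mix t K₁ K₂) i x ≤
      (1 - t i) * callPayoff K₁ i x + t i * callPayoff K₂ i x := by
  have h0 : 0 ≤ t i := ht.1 i
  have h1 : 0 ≤ 1 - t i := sub_nonneg.2 (ht.2 i)
  simp only [callPayoff, mix]
  have a := mul_le_mul_of_nonneg_left (le_max_left (x i - K₁ i) 0) h1
  have b := mul_le_mul_of_nonneg_left (le_max_left (x i - K₂ i) 0) h0
  refine max_le (by linarith) ?_
  exact add_nonneg (mul_nonneg h1 (le_max_right _ _)) (mul_nonneg h0 (le_max_right _ _))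

theorem dualSup_callPayoff_le (hw : ∀ i, 0 < w i) (K p : Fin n → ℝ) (K₀ : ℝ) :
    dualSup (callPayoff K) p (basketPayoff w K₀) ≤ (singleOptionBound w p K K₀ : EReal) :=
  dualSup_le fun x _ => basketPayoff_le_sum_callPayoff hw K K₀ x

/-- Splitting each synthetic call into its two traded neighbours keeps the portfolio dominating, and
its price is exactly the price attached to the interpolated strike. -/
theorem dualSup_two_options_le (hw : ∀ i, 0 < w i) (p₁ p₂ K₁ K₂ : Fin n → ℝ) (K₀ : ℝ)
    {t : Fin n → ℝ} (ht : t ∈ Set.Icc (0 : Fin n → ℝ) 1) :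
    dualSup (Sum.elim (callPayoff K₁) (callPayoff K₂)) (Sum.elim p₁ p₂) (basketPayoff w K₀) ≤
      (singleOptionBound w (mix t p₁ p₂) (mix t K₁ K₂) K₀ : EReal) := by
  have key : Dominates (Sum.elim (callPayoff K₁) (callPayoff K₂)) (basketPayoff w K₀)
      (max ((∑ i, w i * mix t K₁ K₂ i) - K₀) 0)
      (Sum.elim (fun i => w i * (1 - t i)) (fun i => w i * t i)) := by
    intro x _
    refine (basketPayoff_le_sum_callPayoff hw (mix t K₁ K₂) K₀ x).trans ?_
    simp only [Fintype.sum_sum_type, Sum.elim_inl, Sum.elim_inr]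
    rw [← Finset.sum_add_distrib]
    gcongr with i _
    have := mul_le_mul_of_nonneg_left (callPayoff_mix_le ht K₁ K₂ i x) (hw i).le
    linarith
  refine (dualSup_le key).trans (le_of_eq ?_)
  congr 1
  simp only [Fintype.sum_sum_type, Sum.elim_inl, Sum.elim_inr, singleOptionBound]
  rw [← Finset.sum_add_distrib]
  congr 1
  refine Finset.sum_congr rfl fun i _ => ?_
  simp only [mix]
  ring

end Dominating

/-! ### Minimax between mixes t and levels β. -/

section Saddle

/-- The bound `wᵀp₂ + ∑ i, w_i min (p₁_i - p₂_i, β (K₂_i - K₁_i)) - β (K₀ - wᵀK₁)`. -/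
noncomputable def levelBound (w p₁ p₂ K₁ K₂ : Fin n → ℝ) (K₀ β : ℝ) : ℝ :=
  (∑ i, w i * p₂ i) + (∑ i, w i * min (p₁ i - p₂ i) (β * (K₂ i - K₁ i)))
    - β * (K₀ - ∑ i, w i * K₁ i)

/-- The duality gap, split into complementary slackness terms. For t and β in their ranges and w ≥ 0
each is nonnegative; the first vanish when each `t i` weights only the smaller entry of the minimum,
the last when β is a subgradient of the positive part at the strike excess. -/
theorem singleOptionBound_mix_sub_levelBound (w p₁ p₂ K₁ K₂ : Fin n → ℝ) (K₀ β : ℝ)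
    (t : Fin n → ℝ) :
    singleOptionBound w (mix t p₁ p₂) (mix t K₁ K₂) K₀ - levelBound w p₁ p₂ K₁ K₂ K₀ β =
      (∑ i, w i * ((1 - t i) * (p₁ i - p₂ i) + t i * (β * (K₂ i - K₁ i))
          - min (p₁ i - p₂ i) (β * (K₂ i - K₁ i)))) +
        (max ((∑ i, w i * mix t K₁ K₂ i) - K₀) 0 - β * ((∑ i, w i * mix t K₁ K₂ i) - K₀)) := by
  have e : (∑ i, w i * ((1 - t i) * (p₁ i - p₂ i) + t i * (β * (K₂ i - K₁ i))
          - min (p₁ i - p₂ i) (β * (K₂ i - K₁ i)))) =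
      (∑ i, w i * mix t p₁ p₂ i) - (∑ i, w i * p₂ i)
        + β * (∑ i, w i * mix t K₁ K₂ i) - β * (∑ i, w i * K₁ i)
        - ∑ i, w i * min (p₁ i - p₂ i) (β * (K₂ i - K₁ i)) := by
    simp only [Finset.mul_sum, ← Finset.sum_sub_distrib, ← Finset.sum_add_distrib]
    refine Finset.sum_congr rfl fun i _ => ?_
    simp only [mix]
    ring
  rw [e, singleOptionBound, levelBound]
  ring

theorem levelBound_le_singleOptionBound {w : Fin n → ℝ} (hw : ∀ i, 0 < w i)
    (p₁ p₂ K₁ K₂ : Fin n → ℝ) (K₀ : ℝ) {β : ℝ} (hβ : β ∈ Set.Icc (0 : ℝ) 1) {t : Fin n → ℝ}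
    (ht : t ∈ Set.Icc (0 : Fin n → ℝ) 1) :
    levelBound w p₁ p₂ K₁ K₂ K₀ β ≤ singleOptionBound w (mix t p₁ p₂) (mix t K₁ K₂) K₀ := by
  rw [← sub_nonneg, singleOptionBound_mix_sub_levelBound]
  refine add_nonneg (Finset.sum_nonneg fun i _ => mul_nonneg (hw i).le ?_) ?_
  · have h0 : 0 ≤ t i := ht.1 i
    have h1 : 0 ≤ 1 - t i := sub_nonneg.2 (ht.2 i)
    have a := mul_le_mul_of_nonneg_left (min_le_left (p₁ i - p₂ i) (β * (K₂ i - K₁ i))) h1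
    have b := mul_le_mul_of_nonneg_left (min_le_right (p₁ i - p₂ i) (β * (K₂ i - K₁ i))) h0
    linarith
  · generalize (∑ i, w i * mix t K₁ K₂ i) - K₀ = s
    rcases le_total s 0 with h | h
    · rw [max_eq_right h]
      nlinarith [hβ.1]
    · rw [max_eq_left h]
      nlinarith [hβ.2]

/-- A level at which the weight of the superlevel set of `r` crosses `κ`. -/
theorem exists_level (a r : Fin n → ℝ) (κ : ℝ) (hκ : κ < ∑ i, a i) :
    ∃ b, (b = 1 ∨ ∃ j, b = r j) ∧ κ ≤ (∑ i, if b ≤ r i then a i else 0) ∧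
      (b < 1 → (∑ i, if b < r i then a i else 0) ≤ κ) := by
  classical
  set S : Finset ℝ := (insert 1 (Finset.univ.image r)).filter
    fun b => κ ≤ ∑ i, if b ≤ r i then a i else 0 with hS
  have memS : ∀ b, b ∈ S ↔ (b = 1 ∨ ∃ j, b = r j) ∧
      κ ≤ ∑ i, if b ≤ r i then a i else 0 := by
    intro b
    simp [hS, eq_comm]
  have hne : S.Nonempty := by
    -- The smallest candidate collects the total weight, which exceeds κ.
    obtain ⟨b, hb, hmin⟩ := Finset.exists_min_image (insert 1 (Finset.univ.image r)) id
      ⟨1, by simp⟩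
    refine ⟨b, (memS b).2 ⟨by simpa [eq_comm] using hb, ?_⟩⟩
    have : ∀ i, b ≤ r i := fun i => hmin (r i) (by simp)
    simpa [this] using hκ.le
  obtain ⟨b, hb, hmax⟩ := Finset.exists_max_image S id hne
  obtain ⟨hb1, hb2⟩ := (memS b).1 hb
  refine ⟨b, hb1, hb2, fun hlt => ?_⟩
  by_contra! hcon
  -- Let c be the next candidate above b; it exists because 1 is one. Then r i > b exactly when r i
  -- ≥ c, so c would lie in S, against the maximality of b.
  obtain ⟨c, hc, hmin⟩ := Finset.exists_min_image
    ((insert 1 (Finset.univ.image r)).filter fun c => b < c) id ⟨1, by simp [hlt]⟩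
  simp only [Finset.mem_filter, Finset.mem_insert, Finset.mem_image, Finset.mem_univ, true_and]
    at hc hmin
  have hcS : c ∈ S := by
    refine (memS c).2 ⟨by simpa [eq_comm] using hc.1, hcon.le.trans (le_of_eq ?_)⟩
    refine Finset.sum_congr rfl fun i _ => ?_
    have : b < r i ↔ c ≤ r i :=
      ⟨fun h => hmin (r i) ⟨Or.inr ⟨i, rfl⟩, h⟩, fun h => hc.2.trans_le h⟩
    simp only [this]
  exact absurd (hmax c hcS) (not_le.2 hc.2)

/-- Below and above the level t is forced; the ties `r i = b` are free. If b < 1, a common fraction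
on the ties makes the excess vanish. If b = 1, the positive part has slope 1 and a nonnegative
excess suffices. -/
theorem exists_complementary {a r : Fin n → ℝ} {b κ : ℝ} (hb : b ≤ 1)
    (h1 : κ ≤ ∑ i, if b ≤ r i then a i else 0)
    (h2 : b < 1 → (∑ i, if b < r i then a i else 0) ≤ κ) :
    ∃ t ∈ Set.Icc (0 : Fin n → ℝ) 1, (∀ i, r i < b → t i = 0) ∧ (∀ i, b < r i → t i = 1) ∧
      max ((∑ i, a i * t i) - κ) 0 = b * ((∑ i, a i * t i) - κ) := by
  rcases hb.lt_or_eq with hlt | rfl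
  · have hmem : κ ∈ segment ℝ (∑ i, if b < r i then a i else 0) (∑ i, if b ≤ r i then a i else 0) :=
      by rw [segment_eq_Icc ((h2 hlt).trans h1)]; exact ⟨h2 hlt, h1⟩
    obtain ⟨u, v, hu, hv, huv, hκ⟩ := hmem
    refine ⟨fun i => u * (if b < r i then 1 else 0) + v * (if b ≤ r i then 1 else 0),
      ⟨fun i => ?_, fun i => ?_⟩, fun i hi => ?_, fun i hi => ?_, ?_⟩
    · simp only [Pi.zero_apply]
      positivity
    · simp only [Pi.one_apply]
      split_ifs <;> linarith
    · simp [not_lt.2 hi.le, not_le.2 hi]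
    · simp [hi, hi.le, huv]
    · have : (∑ i, a i * (u * (if b < r i then 1 else 0) + v * (if b ≤ r i then 1 else 0)))
          = κ := by
        rw [← hκ, smul_eq_mul, smul_eq_mul, Finset.mul_sum, Finset.mul_sum,
          ← Finset.sum_add_distrib]
        refine Finset.sum_congr rfl fun i _ => ?_
        split_ifs <;> ring
      rw [this]
      simp
  · refine ⟨fun i => if 1 ≤ r i then 1 else 0, ⟨fun i => ?_, fun i => ?_⟩, fun i hi => ?_,
      fun i hi => ?_, ?_⟩
    · simp only [Pi.zero_apply]
      positivity
    · simp only [Pi.one_apply]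
      split_ifs <;> norm_num
    · simp [hi]
    · simp [hi.le]
    · simp only [mul_ite, mul_one, mul_zero, one_mul]
      exact max_eq_left (sub_nonneg.2 h1)

theorem breakpoint_mem {p q K : Fin n → ℝ} (hK : ∀ i, 0 < K i) (hpq : ∀ i, p i < q i)
    (hq : ∀ i, q i ≤ p i + K i) (j : Fin (n + 2)) :
    breakpoint p q K j ∈ Set.Icc (0 : ℝ) 1 := by
  refine Fin.cases ?_ (fun j => ?_) j
  · simp [breakpoint]
  · refine Fin.lastCases ?_ (fun j => ?_) j
    · simp [breakpoint]
    · simp only [breakpoint, Fin.cons_succ, Fin.snoc_castSucc]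
      exact ⟨div_nonneg (sub_nonneg.2 (hpq j).le) (hK j).le,
        (div_le_one (hK j)).2 (by linarith [hq j])⟩

theorem exists_breakpoint_eq (p q K : Fin n → ℝ) {b : ℝ}
    (hb : b = 1 ∨ ∃ j, b = (q j - p j) / K j) : ∃ j, breakpoint p q K j = b := by
  rcases hb with rfl | ⟨j, rfl⟩
  · exact ⟨(Fin.last n).succ, by simp [breakpoint]⟩
  · exact ⟨j.castSucc.succ, by simp [breakpoint]⟩

/-- A saddle point: a breakpoint and a mix at which the lower and the upper bound agree. -/
theorem exists_saddle (w : Fin n → ℝ) {p₁ p₂ K₁ K₂ : Fin n → ℝ}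
    (hK : ∀ i, K₁ i < K₂ i) (hp : ∀ i, p₂ i < p₁ i)
    (hpK : ∀ i, p₁ i ≤ p₂ i + (K₂ i - K₁ i)) (K₀ : ℝ) :
    ∃ j, ∃ t ∈ Set.Icc (0 : Fin n → ℝ) 1,
      singleOptionBound w (mix t p₁ p₂) (mix t K₁ K₂) K₀ =
        levelBound w p₁ p₂ K₁ K₂ K₀ (breakpoint p₂ p₁ (fun i => K₂ i - K₁ i) j) ∧
      (K₀ < ∑ i, w i * K₂ i → 0 < breakpoint p₂ p₁ (fun i => K₂ i - K₁ i) j) := by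
  rcases le_or_gt (∑ i, w i * K₂ i) K₀ with h | h
  -- No interpolated basket strike exceeds `K₀`: the saddle is β = 0 with the upper strikes alone.
  · refine ⟨0, 1, ⟨zero_le_one, le_rfl⟩, ?_, fun h' => absurd h' (not_lt.2 h)⟩
    rw [← sub_eq_zero, singleOptionBound_mix_sub_levelBound]
    simp [breakpoint, mix, h, fun i => (hp i).le]
  · have hd : ∀ i, 0 < K₂ i - K₁ i := fun i => sub_pos.2 (hK i)
    set r : Fin n → ℝ := fun i => (p₁ i - p₂ i) / (K₂ i - K₁ i) with hrdef
    have hr0 : ∀ i, 0 < r i := fun i => div_pos (sub_pos.2 (hp i)) (hd i)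
    have hr1 : ∀ i, r i ≤ 1 := fun i => (div_le_one (hd i)).2 (by linarith [hpK i])
    have hrd : ∀ i, p₁ i - p₂ i = r i * (K₂ i - K₁ i) := fun i =>
      (div_mul_cancel₀ _ (hd i).ne').symm
    obtain ⟨b, hb, h1, h2⟩ := exists_level (fun i => w i * (K₂ i - K₁ i)) r
      (K₀ - ∑ i, w i * K₁ i) (by
        simp only [mul_sub, Finset.sum_sub_distrib]
        linarith)
    have hb1 : b ≤ 1 := by
      rcases hb with rfl | ⟨j, rfl⟩
      exacts [le_rfl, hr1 j]
    have hb0 : 0 < b := by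
      rcases hb with rfl | ⟨j, rfl⟩
      exacts [one_pos, hr0 j]
    obtain ⟨t, ht, ht0, ht1, htm⟩ := exists_complementary hb1 h1 h2
    obtain ⟨j, hj⟩ := exists_breakpoint_eq p₂ p₁ (fun i => K₂ i - K₁ i) hb
    refine ⟨j, t, ht, ?_, fun _ => hj ▸ hb0⟩
    rw [hj, ← sub_eq_zero, singleOptionBound_mix_sub_levelBound]
    have e : (∑ i, w i * (K₂ i - K₁ i) * t i) - (K₀ - ∑ i, w i * K₁ i) =
        (∑ i, w i * mix t K₁ K₂ i) - K₀ := by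
      rw [sub_sub_eq_add_sub, ← Finset.sum_add_distrib]
      congr 1
      refine Finset.sum_congr rfl fun i _ => ?_
      simp only [mix]
      ring
    rw [e] at htm
    rw [htm, sub_self, add_zero]
    refine Finset.sum_eq_zero fun i _ => ?_
    rw [hrd i]
    -- At a tie both entries of the minimum coincide, so the value of `t i` is irrelevant.
    rcases lt_trichotomy (r i) b with hi | hi | hi
    · rw [ht0 i hi, min_eq_left (mul_le_mul_of_nonneg_right hi.le (hd i).le)]
      ring
    · rw [hi, min_self]
      ring
    · rw [ht1 i hi, min_eq_right (mul_le_mul_of_nonneg_right hi.le (hd i).le)]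
      ring

theorem closedForm_eq_sup' (w p₁ p₂ K₁ K₂ : Fin n → ℝ) (K₀ : ℝ) :
    closedForm w p₂ p₁ (fun i => K₂ i - K₁ i) (K₀ - ∑ i, w i * K₁ i) =
      Finset.univ.sup' Finset.univ_nonempty fun j : Fin (n + 2) =>
        levelBound w p₁ p₂ K₁ K₂ K₀ (breakpoint p₂ p₁ (fun i => K₂ i - K₁ i) j) :=
  rfl

end Saddle

/-! ### Extremal comonotone distributions. -/

section Scenario

/-- The uniform distribution on the unit interval. -/
noncomputable def unitLaw : Measure ℝ := volume.restrict (Set.Ioc 0 1)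

instance : IsProbabilityMeasure unitLaw := ⟨by simp [unitLaw]⟩

/-- The payoff of one unit of cash in the states `u ≤ s`. -/
noncomputable def step (s u : ℝ) : ℝ := (Set.Iic s).indicator 1 u

theorem step_of_le {s u : ℝ} (h : u ≤ s) : step s u = 1 := by simp [step, h]

theorem step_of_lt {s u : ℝ} (h : s < u) : step s u = 0 := by simp [step, h]

theorem measurable_step (s : ℝ) : Measurable (step s) :=
  measurable_one.indicator measurableSet_Iic

theorem integrable_step (s : ℝ) : Integrable (step s) unitLaw :=
  (integrable_const (1 : ℝ)).indicator measurableSet_Iic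

theorem integral_step {s : ℝ} (h0 : 0 ≤ s) (h1 : s ≤ 1) : ∫ u, step s u ∂unitLaw = s := by
  have : ∫ u, step s u ∂unitLaw = unitLaw.real (Set.Iic s) :=
    integral_indicator_one measurableSet_Iic
  rw [this, measureReal_def, unitLaw, Measure.restrict_apply measurableSet_Iic]
  have e : Set.Iic s ∩ Set.Ioc 0 1 = Set.Ioc 0 s := by
    ext u
    simp only [Set.mem_inter_iff, Set.mem_Iic, Set.mem_Ioc]
    constructor
    · rintro ⟨a, b, _⟩
      exact ⟨b, a⟩
    · rintro ⟨a, b⟩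
      exact ⟨b, a, b.trans h1⟩
  rw [e, Real.volume_Ioc, sub_zero, ENNReal.toReal_ofReal h0]

/-- Asset prices in the state `u`: asset `i` is worth `K₁_i` for `u > r_i`, `K₂_i` for
`u ≤ r_i`, plus a bonus of mean `p₂_i` spread over `u ≤ min r_i β`. -/
noncomputable def scenario (K₁ K₂ p₂ r : Fin n → ℝ) (β u : ℝ) : Fin n → ℝ := fun i =>
  K₁ i + (K₂ i - K₁ i) * step (r i) u + p₂ i / min (r i) β * step (min (r i) β) u

variable {K₁ K₂ p₂ r : Fin n → ℝ} {β : ℝ}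

theorem measurable_scenario (K₁ K₂ p₂ r : Fin n → ℝ) (β : ℝ) :
    Measurable (scenario K₁ K₂ p₂ r β) :=
  measurable_pi_lambda _ fun _ =>
    (measurable_const.add ((measurable_step _).const_mul _)).add ((measurable_step _).const_mul _)

theorem integrable_scenario_apply (K₁ K₂ p₂ r : Fin n → ℝ) (β : ℝ) (i : Fin n) :
    Integrable (fun u => scenario K₁ K₂ p₂ r β u i) unitLaw :=
  ((integrable_const _).add ((integrable_step _).const_mul _)).add
    ((integrable_step _).const_mul _)

theorem scenario_nonneg (hK₁ : ∀ i, 0 ≤ K₁ i) (hK : ∀ i, K₁ i < K₂ i) (hp₂ : ∀ i, 0 ≤ p₂ i)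
    (hr : ∀ i, 0 < r i) (hβ : 0 < β) (u : ℝ) (i : Fin n) : 0 ≤ scenario K₁ K₂ p₂ r β u i := by
  have hs : ∀ s, 0 ≤ step s u := fun s => Set.indicator_nonneg (by simp) u
  have := sub_nonneg.2 (hK i).le
  have := hs (r i)
  have := hs (min (r i) β)
  have := hK₁ i
  have := hp₂ i
  have := (lt_min (hr i) hβ).le
  unfold scenario
  positivity

theorem finite_range_scenario (K₁ K₂ p₂ r : Fin n → ℝ) (β : ℝ) :
    (Set.range (scenario K₁ K₂ p₂ r β)).Finite := by
  have hs : ∀ s u, step s u ∈ ({0, 1} : Set ℝ) := by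
    intro s u
    rcases le_or_gt u s with h | h
    · simp [step_of_le h]
    · simp [step_of_lt h]
  have hfin : ∀ i, (Set.image2 (fun a b => K₁ i + (K₂ i - K₁ i) * a + p₂ i / min (r i) β * b)
      ({0, 1} : Set ℝ) {0, 1}).Finite := fun i => Set.Finite.image2 _ (by simp) (by simp)
  refine (Set.Finite.pi' hfin).subset ?_
  rintro _ ⟨u, rfl⟩ i
  exact ⟨_, hs (r i) u, _, hs (min (r i) β) u, rfl⟩

/-- The price of asset i is either `K₁ i` or at least `K₂ i`, never strictly between, so every
strike between the two is exercised in the same states, up to zero payoffs, and the payoff is affine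
in t. -/
theorem callPayoff_scenario (hK : ∀ i, K₁ i < K₂ i) (hp₂ : ∀ i, 0 ≤ p₂ i)
    (hr : ∀ i, 0 < r i) (hβ : 0 < β) {t : Fin n → ℝ} (ht : t ∈ Set.Icc (0 : Fin n → ℝ) 1)
    (i : Fin n) (u : ℝ) :
    callPayoff (mix t K₁ K₂) i (scenario K₁ K₂ p₂ r β u) =
      (1 - t i) * (K₂ i - K₁ i) * step (r i) u
        + p₂ i / min (r i) β * step (min (r i) β) u := by
  have hd := sub_nonneg.2 (hK i).le
  have h0 : 0 ≤ t i := ht.1 i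
  have h1 : 0 ≤ 1 - t i := sub_nonneg.2 (ht.2 i)
  have hb : 0 ≤ p₂ i / min (r i) β := div_nonneg (hp₂ i) (lt_min (hr i) hβ).le
  simp only [callPayoff, mix, scenario]
  rcases le_or_gt u (r i) with h | h
  · have hs : 0 ≤ step (min (r i) β) u := Set.indicator_nonneg (by simp) u
    rw [step_of_le h, max_eq_left]
    · ring
    · have := mul_nonneg h1 hd
      have := mul_nonneg hb hs
      nlinarith
  · rw [step_of_lt h, step_of_lt ((min_le_left _ _).trans_lt h), max_eq_right]
    · ring
    · nlinarith

/-- The distribution of the asset prices in `scenario`. -/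
noncomputable def scenarioLaw (K₁ K₂ p₂ r : Fin n → ℝ) (β : ℝ) : Measure (Fin n → ℝ) :=
  unitLaw.map (scenario K₁ K₂ p₂ r β)

theorem hasFiniteSupport_scenarioLaw (K₁ K₂ p₂ r : Fin n → ℝ) (β : ℝ) :
    HasFiniteSupport (scenarioLaw K₁ K₂ p₂ r β) := by
  refine ⟨(finite_range_scenario K₁ K₂ p₂ r β).toFinset, ?_⟩
  rw [scenarioLaw, Measure.map_apply (measurable_scenario _ _ _ _ _)
    (Finset.measurableSet _).compl]
  convert measure_empty (μ := unitLaw)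
  ext u
  simp

theorem isFeasible_scenarioLaw (hK₁ : ∀ i, 0 ≤ K₁ i) (hK : ∀ i, K₁ i < K₂ i)
    (hp₂ : ∀ i, 0 ≤ p₂ i) (hr : ∀ i, 0 < r i) (hr1 : ∀ i, r i ≤ 1) (hβ : 0 < β)
    {p₁ : Fin n → ℝ} (hp₁ : ∀ i, p₁ i = p₂ i + r i * (K₂ i - K₁ i))
    {t : Fin n → ℝ} (ht : t ∈ Set.Icc (0 : Fin n → ℝ) 1) :
    IsFeasible (callPayoff (mix t K₁ K₂)) (mix t p₁ p₂) (scenarioLaw K₁ K₂ p₂ r β) := by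
  have hX := measurable_scenario K₁ K₂ p₂ r β
  refine ⟨Measure.isProbabilityMeasure_map hX.aemeasurable, ?_, fun i => ?_⟩
  · refine (ae_map_iff hX.aemeasurable ?_).2
      (ae_of_all _ (scenario_nonneg hK₁ hK hp₂ hr hβ))
    rw [Set.ofPred_forall]
    exact MeasurableSet.iInter fun i => measurableSet_le measurable_const (measurable_pi_apply i)
  · have hm : Measurable (callPayoff (mix t K₁ K₂) i) :=
      ((measurable_pi_apply i).sub_const _).max measurable_const
    have e : callPayoff (mix t K₁ K₂) i ∘ scenario K₁ K₂ p₂ r β = fun u =>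
        (1 - t i) * (K₂ i - K₁ i) * step (r i) u
          + p₂ i / min (r i) β * step (min (r i) β) u :=
      funext (callPayoff_scenario hK hp₂ hr hβ ht i)
    have hρ := lt_min (hr i) hβ
    constructor
    · rw [scenarioLaw, integrable_map_measure hm.aestronglyMeasurable hX.aemeasurable, e]
      exact ((integrable_step _).const_mul _).add ((integrable_step _).const_mul _)
    · rw [scenarioLaw, integral_map hX.aemeasurable hm.aestronglyMeasurable]
      change ∫ u, (callPayoff (mix t K₁ K₂) i ∘ scenario K₁ K₂ p₂ r β) u ∂unitLaw = _
      rw [e, integral_add ((integrable_step _).const_mul _) ((integrable_step _).const_mul _),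
        integral_const_mul, integral_const_mul, integral_step (hr i).le (hr1 i),
        integral_step hρ.le ((min_le_left _ _).trans (hr1 i)), div_mul_cancel₀ _ hρ.ne', mix,
        hp₁ i]
      ring

theorem measurable_basketPayoff (w : Fin n → ℝ) (K₀ : ℝ) : Measurable (basketPayoff w K₀) :=
  ((Finset.measurable_sum _ fun i _ => (measurable_pi_apply i).const_mul _).sub_const _).max
    measurable_const

theorem integrable_basketPayoff_scenario (w : Fin n → ℝ) (K₀ : ℝ)
    (K₁ K₂ p₂ r : Fin n → ℝ) (β : ℝ) :
    Integrable (fun u => basketPayoff w K₀ (scenario K₁ K₂ p₂ r β u)) unitLaw :=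
  ((integrable_finsetSum _ fun i _ =>
    (integrable_scenario_apply K₁ K₂ p₂ r β i).const_mul (w i)).sub (integrable_const K₀)).pos_part

theorem integrable_basketPayoff_scenarioLaw (w : Fin n → ℝ) (K₀ : ℝ)
    (K₁ K₂ p₂ r : Fin n → ℝ) (β : ℝ) :
    Integrable (basketPayoff w K₀) (scenarioLaw K₁ K₂ p₂ r β) :=
  (integrable_map_measure (measurable_basketPayoff w K₀).aestronglyMeasurable
    (measurable_scenario K₁ K₂ p₂ r β).aemeasurable).2
    (integrable_basketPayoff_scenario w K₀ K₁ K₂ p₂ r β)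

theorem levelBound_le_integral_scenarioLaw (w : Fin n → ℝ) (K₀ : ℝ) (hK : ∀ i, K₁ i < K₂ i)
    (hr : ∀ i, 0 < r i) (hr1 : ∀ i, r i ≤ 1)
    (hβ : 0 < β) (hβ1 : β ≤ 1) {p₁ : Fin n → ℝ}
    (hp₁ : ∀ i, p₁ i = p₂ i + r i * (K₂ i - K₁ i)) :
    levelBound w p₁ p₂ K₁ K₂ K₀ β ≤
      ∫ x, basketPayoff w K₀ x ∂(scenarioLaw K₁ K₂ p₂ r β) := by
  have hX := measurable_scenario K₁ K₂ p₂ r β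
  rw [scenarioLaw, integral_map hX.aemeasurable
    (measurable_basketPayoff w K₀).aestronglyMeasurable]
  -- L is the gain from exercising exactly in the states u ≤ β, whether or not this is profitable.
  -- The bonus lives inside those states, so its whole mean is collected.
  set L : ℝ → ℝ := fun u => (∑ i, w i * (K₁ i * step β u
    + (K₂ i - K₁ i + p₂ i / min (r i) β) * step (min (r i) β) u)) - K₀ * step β u with hL
  have hterm : ∀ i, Integrable (fun u => w i * (K₁ i * step β u
      + (K₂ i - K₁ i + p₂ i / min (r i) β) * step (min (r i) β) u)) unitLaw := fun i =>
    (((integrable_step _).const_mul _).add ((integrable_step _).const_mul _)).const_mul _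
  have hLint : Integrable L unitLaw :=
    (integrable_finsetSum _ fun i _ => hterm i).sub ((integrable_step _).const_mul _)
  have hLval : ∫ u, L u ∂unitLaw = levelBound w p₁ p₂ K₁ K₂ K₀ β := by
    rw [hL, integral_sub (integrable_finsetSum _ fun i _ => hterm i)
      ((integrable_step _).const_mul _), integral_finsetSum _ fun i _ => hterm i,
      integral_const_mul, integral_step hβ.le hβ1, levelBound, mul_sub, Finset.mul_sum,
      ← Finset.sum_add_distrib, mul_comm β K₀]
    have : ∀ a b c d : ℝ, a = b + d → a - c = b - (c - d) := by intros; linarith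
    refine this _ _ _ _ ?_
    rw [← Finset.sum_add_distrib]
    refine Finset.sum_congr rfl fun i _ => ?_
    have hρ := lt_min (hr i) hβ
    have hmin : min (p₁ i - p₂ i) (β * (K₂ i - K₁ i)) = min (r i) β * (K₂ i - K₁ i) := by
      rw [min_mul_of_nonneg _ _ (sub_nonneg.2 (hK i).le), hp₁ i, add_sub_cancel_left]
    rw [integral_const_mul, integral_add ((integrable_step _).const_mul _)
      ((integrable_step _).const_mul _), integral_const_mul, integral_const_mul,
      integral_step hβ.le hβ1, integral_step hρ.le ((min_le_left _ _).trans (hr1 i)), hmin]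
    field_simp
    ring
  rw [← hLval]
  refine integral_mono hLint (integrable_basketPayoff_scenario w K₀ K₁ K₂ p₂ r β) fun u => ?_
  rcases le_or_gt u β with hu | hu
  · refine (le_of_eq ?_).trans (le_max_left _ _)
    simp only [hL, step_of_le hu, mul_one, scenario]
    congr 1
    refine Finset.sum_congr rfl fun i _ => ?_
    have : step (r i) u = step (min (r i) β) u := by
      rcases le_or_gt u (r i) with h | h
      · rw [step_of_le h, step_of_le (le_min h hu)]
      · rw [step_of_lt h, step_of_lt ((min_le_left _ _).trans_lt h)]
    rw [this]
    ring
  · have : L u = 0 := by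
      simp [hL, step_of_lt hu, step_of_lt (lt_of_le_of_lt (min_le_right _ β) hu)]
    rw [this]
    exact basketPayoff_nonneg _ _ _

end Scenario

/-! ### The squeeze for two options per asset. -/

theorem mix_zero_left (a b : Fin n → ℝ) : mix 0 a b = a := by
  ext i
  simp [mix]

theorem mix_one_left (a b : Fin n → ℝ) : mix 1 a b = b := by
  ext i
  simp [mix]

theorem IsFeasible.sum_elim {φ₁ φ₂ : Fin n → (Fin n → ℝ) → ℝ} {c₁ c₂ : Fin n → ℝ}
    {π : Measure (Fin n → ℝ)} (h₁ : IsFeasible φ₁ c₁ π) (h₂ : IsFeasible φ₂ c₂ π) :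
    IsFeasible (Sum.elim φ₁ φ₂) (Sum.elim c₁ c₂) π :=
  ⟨h₁.1, h₁.2.1, Sum.rec h₁.2.2 h₂.2.2⟩

theorem tendsto_levelBound_zero (w p₁ p₂ K₁ K₂ : Fin n → ℝ) (hp : ∀ i, p₂ i < p₁ i) (K₀ : ℝ) :
    Tendsto (fun k : ℕ => levelBound w p₁ p₂ K₁ K₂ K₀ (1 / ((k : ℝ) + 1))) atTop
      (𝓝 (∑ i, w i * p₂ i)) := by
  have hc : Continuous (levelBound w p₁ p₂ K₁ K₂ K₀) := by
    unfold levelBound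
    fun_prop
  have h := (hc.tendsto 0).comp tendsto_one_div_add_atTop_nhds_zero_nat
  have e : levelBound w p₁ p₂ K₁ K₂ K₀ 0 = ∑ i, w i * p₂ i := by
    simp [levelBound, fun i => (hp i).le]
  rwa [e] at h

theorem two_options_per_asset {w : Fin n → ℝ} (hw : ∀ i, 0 < w i) (K₀ : ℝ)
    {p₁ p₂ K₁ K₂ : Fin n → ℝ} (hK₁ : ∀ i, 0 ≤ K₁ i) (hK : ∀ i, K₁ i < K₂ i)
    (hp₂ : ∀ i, 0 ≤ p₂ i) (hp : ∀ i, p₂ i < p₁ i) (hpK : ∀ i, p₁ i ≤ p₂ i + (K₂ i - K₁ i))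
    {d : ℝ} (hd : d = closedForm w p₂ p₁ (fun i => K₂ i - K₁ i) (K₀ - ∑ i, w i * K₁ i)) :
    primalSup (Sum.elim (callPayoff K₁) (callPayoff K₂)) (Sum.elim p₁ p₂) (basketPayoff w K₀)
        = dualSup (Sum.elim (callPayoff K₁) (callPayoff K₂)) (Sum.elim p₁ p₂)
            (basketPayoff w K₀) ∧
    dualSup (Sum.elim (callPayoff K₁) (callPayoff K₂)) (Sum.elim p₁ p₂) (basketPayoff w K₀)
        = (d : EReal) ∧
    (∃ t, IsOptimalMix w p₁ p₂ K₁ K₂ K₀ t) ∧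
    (∀ t, IsOptimalMix w p₁ p₂ K₁ K₂ K₀ t →
      d = singleOptionBound w (mix t p₁ p₂) (mix t K₁ K₂) K₀ ∧
      primalSup (callPayoff (mix t K₁ K₂)) (mix t p₁ p₂) (basketPayoff w K₀) = (d : EReal) ∧
      dualSup (callPayoff (mix t K₁ K₂)) (mix t p₁ p₂) (basketPayoff w K₀) = (d : EReal)) ∧
    (∑ i, w i * K₂ i ≤ K₀ →
      (∀ t, IsOptimalMix w p₁ p₂ K₁ K₂ K₀ t → t = 1) ∧
      d = ∑ i, w i * p₂ i ∧
      ∃ π : ℕ → Measure (Fin n → ℝ),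
        (∀ k, IsFeasible (Sum.elim (callPayoff K₁) (callPayoff K₂)) (Sum.elim p₁ p₂) (π k) ∧
          HasFiniteSupport (π k)) ∧
        Tendsto (fun k => ∫ x, basketPayoff w K₀ x ∂(π k)) atTop (𝓝 d)) ∧
    (K₀ < ∑ i, w i * K₂ i →
      ∃ π : Measure (Fin n → ℝ),
        IsFeasible (Sum.elim (callPayoff K₁) (callPayoff K₂)) (Sum.elim p₁ p₂) π ∧
        HasFiniteSupport π ∧
        ∫ x, basketPayoff w K₀ x ∂π = d) := by
  set F : (Fin n → ℝ) → ℝ := fun t => singleOptionBound w (mix t p₁ p₂) (mix t K₁ K₂) K₀ with hF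
  set D : ℝ → ℝ := levelBound w p₁ p₂ K₁ K₂ K₀ with hD
  set b : Fin (n + 2) → ℝ := breakpoint p₂ p₁ (fun i => K₂ i - K₁ i) with hb
  have hb01 : ∀ j, b j ∈ Set.Icc (0 : ℝ) 1 := breakpoint_mem (fun i => sub_pos.2 (hK i)) hp hpK
  obtain ⟨j₀, t₀, ht₀, hFD, hpos⟩ := exists_saddle w hK hp hpK K₀
  change F t₀ = D (b j₀) at hFD
  rw [closedForm_eq_sup'] at hd
  have hdF : ∀ t ∈ Set.Icc (0 : Fin n → ℝ) 1, d ≤ F t := fun t ht => by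
    rw [hd]
    exact Finset.sup'_le _ _ fun j _ => levelBound_le_singleOptionBound hw _ _ _ _ _ (hb01 j) ht
  have hdD : d = D (b j₀) := by
    refine le_antisymm (hFD ▸ hdF t₀ ht₀) ?_
    rw [hd]
    exact Finset.le_sup' (fun j => D (b j)) (Finset.mem_univ j₀)
  have hopt : ∀ t, IsOptimalMix w p₁ p₂ K₁ K₂ K₀ t → d = F t := fun t ht =>
    le_antisymm (hdF t ht.1) ((ht.2 ht₀).trans_eq (hFD.trans hdD.symm))
  have hopt₀ : IsOptimalMix w p₁ p₂ K₁ K₂ K₀ t₀ :=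
    ⟨ht₀, fun t ht => (hFD.trans hdD.symm).trans_le (hdF t ht)⟩
  set r : Fin n → ℝ := fun i => (p₁ i - p₂ i) / (K₂ i - K₁ i) with hr
  have hΔ : ∀ i, 0 < K₂ i - K₁ i := fun i => sub_pos.2 (hK i)
  have hr0 : ∀ i, 0 < r i := fun i => div_pos (sub_pos.2 (hp i)) (hΔ i)
  have hr1 : ∀ i, r i ≤ 1 := fun i => (div_le_one (hΔ i)).2 (by linarith [hpK i])
  have hp₁ : ∀ i, p₁ i = p₂ i + r i * (K₂ i - K₁ i) := fun i => by
    rw [hr, div_mul_cancel₀ _ (hΔ i).ne', add_sub_cancel]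
  set P : ℝ → Measure (Fin n → ℝ) := scenarioLaw K₁ K₂ p₂ r with hP
  have hmixfeas : ∀ β, 0 < β → ∀ t ∈ Set.Icc (0 : Fin n → ℝ) 1,
      IsFeasible (callPayoff (mix t K₁ K₂)) (mix t p₁ p₂) (P β) := fun β hβ t ht =>
    isFeasible_scenarioLaw hK₁ hK hp₂ hr0 hr1 hβ hp₁ ht
  have hfeas : ∀ β, 0 < β →
      IsFeasible (Sum.elim (callPayoff K₁) (callPayoff K₂)) (Sum.elim p₁ p₂) (P β) := by
    intro β hβ
    -- The traded strikes are the extreme mixes t = 0 and t = 1.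
    have h₁ := hmixfeas β hβ 0 ⟨le_rfl, zero_le_one⟩
    have h₂ := hmixfeas β hβ 1 ⟨zero_le_one, le_rfl⟩
    rw [mix_zero_left, mix_zero_left] at h₁
    rw [mix_one_left, mix_one_left] at h₂
    exact h₁.sum_elim h₂
  have hψint : ∀ β, Integrable (basketPayoff w K₀) (P β) :=
    integrable_basketPayoff_scenarioLaw w K₀ K₁ K₂ p₂ r
  have hlow : ∀ β, 0 < β → β ≤ 1 → D β ≤ ∫ x, basketPayoff w K₀ x ∂(P β) := fun β hβ hβ1 =>
    levelBound_le_integral_scenarioLaw w K₀ hK hr0 hr1 hβ hβ1 hp₁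
  have hdual : dualSup (Sum.elim (callPayoff K₁) (callPayoff K₂)) (Sum.elim p₁ p₂)
      (basketPayoff w K₀) ≤ (d : EReal) :=
    (dualSup_two_options_le hw p₁ p₂ K₁ K₂ K₀ ht₀).trans_eq
      (congrArg Real.toEReal (hopt t₀ hopt₀).symm)
  have hweak := primalSup_le_dualSup (Sum.elim (callPayoff K₁) (callPayoff K₂))
    (Sum.elim p₁ p₂) (basketPayoff_nonneg w K₀)
  have hup : ∀ β, 0 < β → ∫ x, basketPayoff w K₀ x ∂(P β) ≤ d := fun β hβ =>
    EReal.coe_le_coe_iff.1 ((((hfeas β hβ).integral_le_primalSup (basketPayoff_nonneg w K₀)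
      (hψint β)).trans hweak).trans hdual)
  have hinterior : K₀ < ∑ i, w i * K₂ i → ∫ x, basketPayoff w K₀ x ∂(P (b j₀)) = d := fun h =>
    le_antisymm (hup _ (hpos h)) (hdD.trans_le (hlow _ (hpos h) (hb01 j₀).2))
  have hboundary : ∑ i, w i * K₂ i ≤ K₀ →
      (∀ t, IsOptimalMix w p₁ p₂ K₁ K₂ K₀ t → t = 1) ∧ d = ∑ i, w i * p₂ i := by
    intro h
    -- Here the positive part vanishes on the whole cube, so F is affine with slope `-w i * (p₁ i -
    -- p₂ i) < 0` in each `t i`; its only minimizer is t = 1.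
    have hFt : ∀ t ∈ Set.Icc (0 : Fin n → ℝ) 1, F t =
        (∑ i, w i * p₂ i) + ∑ i, w i * ((1 - t i) * (p₁ i - p₂ i)) := by
      intro t ht
      have hle : ∑ i, w i * mix t K₁ K₂ i ≤ K₀ := by
        refine le_trans (Finset.sum_le_sum fun i _ => mul_le_mul_of_nonneg_left ?_ (hw i).le) h
        have := mul_nonneg (sub_nonneg.2 (ht.2 i)) (hΔ i).le
        simp only [mix, Pi.one_apply] at *
        linarith
      simp only [hF, singleOptionBound]
      rw [max_eq_right (sub_nonpos.2 hle), add_zero, ← Finset.sum_add_distrib]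
      refine Finset.sum_congr rfl fun i _ => ?_
      simp only [mix]
      ring
    have hnn : ∀ t ∈ Set.Icc (0 : Fin n → ℝ) 1, ∀ i, 0 ≤ w i * ((1 - t i) * (p₁ i - p₂ i)) :=
      fun t ht i => mul_nonneg (hw i).le
        (mul_nonneg (sub_nonneg.2 (ht.2 i)) (sub_pos.2 (hp i)).le)
    have h1 : (1 : Fin n → ℝ) ∈ Set.Icc (0 : Fin n → ℝ) 1 := ⟨zero_le_one, le_rfl⟩
    have hF1 : F 1 = ∑ i, w i * p₂ i := by simp [hFt 1 h1]
    have hd1 : d = ∑ i, w i * p₂ i := by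
      refine le_antisymm (hF1 ▸ hdF 1 h1) ?_
      rw [hopt t₀ hopt₀, hFt t₀ ht₀]
      exact le_add_of_nonneg_right (Finset.sum_nonneg fun i _ => hnn t₀ ht₀ i)
    refine ⟨fun t ht => ?_, hd1⟩
    have hsum : ∑ i, w i * ((1 - t i) * (p₁ i - p₂ i)) = 0 := by
      have := hopt t ht
      rw [hFt t ht.1, hd1] at this
      linarith
    rw [Finset.sum_eq_zero_iff_of_nonneg fun i _ => hnn t ht.1 i] at hsum
    ext i
    have := hsum i (Finset.mem_univ i)
    rw [mul_eq_zero, mul_eq_zero] at this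
    rcases this with h' | h' | h'
    · exact absurd h' (hw i).ne'
    · exact (sub_eq_zero.1 h').symm
    · exact absurd h' (sub_pos.2 (hp i)).ne'
  have hinv : ∀ k : ℕ, 0 < 1 / ((k : ℝ) + 1) ∧ 1 / ((k : ℝ) + 1) ≤ 1 := fun k =>
    ⟨Nat.one_div_pos_of_nat, (div_le_one (by positivity)).2 (by simp)⟩
  have hlim : ∑ i, w i * K₂ i ≤ K₀ →
      Tendsto (fun k : ℕ => ∫ x, basketPayoff w K₀ x ∂(P (1 / ((k : ℝ) + 1)))) atTop (𝓝 d) := by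
    intro h
    have ht := tendsto_levelBound_zero w p₁ p₂ K₁ K₂ hp K₀
    rw [← (hboundary h).2] at ht
    exact tendsto_of_tendsto_of_tendsto_of_le_of_le ht tendsto_const_nhds
      (fun k => hlow _ (hinv k).1 (hinv k).2) (fun k => hup _ (hinv k).1)
  -- Stated for arbitrary constraints met by all the laws `P β`, so that it serves both the original
  -- and the synthetic problem.
  have hprimal : ∀ {ι : Type} (φ : ι → (Fin n → ℝ) → ℝ) (c : ι → ℝ),
      (∀ β, 0 < β → IsFeasible φ c (P β)) → (d : EReal) ≤ primalSup φ c (basketPayoff w K₀) := by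
    intro ι φ c hφ
    have hle : ∀ β, 0 < β → ((∫ x, basketPayoff w K₀ x ∂(P β) : ℝ) : EReal) ≤
        primalSup φ c (basketPayoff w K₀) := fun β hβ =>
      (hφ β hβ).integral_le_primalSup (basketPayoff_nonneg w K₀) (hψint β)
    rcases le_or_gt (∑ i, w i * K₂ i) K₀ with h | h
    · exact le_of_tendsto ((continuous_coe_real_ereal.tendsto d).comp (hlim h))
        (Eventually.of_forall fun k => hle _ (hinv k).1)
    · exact hinterior h ▸ hle _ (hpos h)
  have hpd := hprimal _ _ hfeas
  refine ⟨le_antisymm hweak (hdual.trans hpd), le_antisymm hdual (hpd.trans hweak),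
    ⟨t₀, hopt₀⟩, fun t ht => ?_, fun h => ⟨(hboundary h).1, (hboundary h).2,
      fun k => P (1 / ((k : ℝ) + 1)), fun k => ⟨hfeas _ (hinv k).1,
        hasFiniteSupport_scenarioLaw _ _ _ _ _⟩, hlim h⟩,
    fun h => ⟨P (b j₀), hfeas _ (hpos h), hasFiniteSupport_scenarioLaw _ _ _ _ _, hinterior h⟩⟩
  have hs := hprimal _ _ fun β hβ => hmixfeas β hβ t ht.1
  have hsweak := primalSup_le_dualSup (callPayoff (mix t K₁ K₂)) (mix t p₁ p₂)
    (basketPayoff_nonneg w K₀)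
  have hsdual : dualSup (callPayoff (mix t K₁ K₂)) (mix t p₁ p₂) (basketPayoff w K₀) ≤
      (d : EReal) :=
    (dualSup_callPayoff_le hw _ _ K₀).trans_eq (congrArg Real.toEReal (hopt t ht).symm)
  exact ⟨hopt t ht, le_antisymm (hsweak.trans hsdual) hs, le_antisymm hsdual (hs.trans hsweak)⟩

/-! ### Forwards as calls with strike zero. -/

theorem forwardPayoff_eq_callPayoff_zero (K : Fin n → ℝ) (j : Fin n ⊕ Fin n) (x : Fin n → ℝ)
    (hx : ∀ i, 0 ≤ x i) :
    Sum.elim (callPayoff 0) (callPayoff K) j x = Sum.elim forwardPayoff (callPayoff K) j x := by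
  rcases j with i | i
  · simp [callPayoff, forwardPayoff, hx i]
  · rfl

end BasketBounds

theorem mainTheorem6 (n : ℕ) (w : Fin n → ℝ) (hw : ∀ i, 0 < w i) (K₀ : ℝ) (hK₀ : 0 ≤ K₀) :
    -- one forward and one option per asset
    (∀ p q K : Fin n → ℝ, (∀ i, 0 ≤ K i) → (∀ i, 0 ≤ p i) → (∀ i, p i < q i) →
      (∀ i, q i ≤ p i + K i) →
      primalSup (Sum.elim forwardPayoff (callPayoff K)) (Sum.elim q p) (basketPayoff w K₀)
          = dualSup (Sum.elim forwardPayoff (callPayoff K)) (Sum.elim q p) (basketPayoff w K₀) ∧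
      dualSup (Sum.elim forwardPayoff (callPayoff K)) (Sum.elim q p) (basketPayoff w K₀)
          = (closedForm w p q K K₀ : EReal) ∧
      (∃ t, IsOptimalMix w q p 0 K K₀ t) ∧
      (∀ t, IsOptimalMix w q p 0 K K₀ t →
        closedForm w p q K K₀ = singleOptionBound w (mix t q p) (fun i => t i * K i) K₀ ∧
        primalSup (callPayoff fun i => t i * K i) (mix t q p) (basketPayoff w K₀)
          = (closedForm w p q K K₀ : EReal) ∧
        dualSup (callPayoff fun i => t i * K i) (mix t q p) (basketPayoff w K₀)
          = (closedForm w p q K K₀ : EReal)) ∧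
      (∑ i, w i * K i ≤ K₀ →
        (∀ t, IsOptimalMix w q p 0 K K₀ t → t = 1) ∧
        closedForm w p q K K₀ = ∑ i, w i * p i ∧
        ∃ π : ℕ → Measure (Fin n → ℝ),
          (∀ k, IsFeasible (Sum.elim forwardPayoff (callPayoff K)) (Sum.elim q p) (π k) ∧
            HasFiniteSupport (π k)) ∧
          Tendsto (fun k => ∫ x, basketPayoff w K₀ x ∂(π k)) atTop
            (𝓝 (closedForm w p q K K₀))) ∧
      (K₀ < ∑ i, w i * K i →
        ∃ π : Measure (Fin n → ℝ),
          IsFeasible (Sum.elim forwardPayoff (callPayoff K)) (Sum.elim q p) π ∧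
          HasFiniteSupport π ∧
          ∫ x, basketPayoff w K₀ x ∂π = closedForm w p q K K₀)) ∧
    -- two options per asset
    (∀ p₁ p₂ K₁ K₂ : Fin n → ℝ, (∀ i, 0 ≤ K₁ i) → (∀ i, K₁ i < K₂ i) → (∀ i, 0 ≤ p₂ i) →
      (∀ i, p₂ i < p₁ i) → (∀ i, p₁ i ≤ p₂ i + (K₂ i - K₁ i)) →
      ∀ d : ℝ, d = closedForm w p₂ p₁ (fun i => K₂ i - K₁ i) (K₀ - ∑ i, w i * K₁ i) →
      primalSup (Sum.elim (callPayoff K₁) (callPayoff K₂)) (Sum.elim p₁ p₂) (basketPayoff w K₀)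
          = dualSup (Sum.elim (callPayoff K₁) (callPayoff K₂)) (Sum.elim p₁ p₂)
              (basketPayoff w K₀) ∧
      dualSup (Sum.elim (callPayoff K₁) (callPayoff K₂)) (Sum.elim p₁ p₂) (basketPayoff w K₀)
          = (d : EReal) ∧
      (∃ t, IsOptimalMix w p₁ p₂ K₁ K₂ K₀ t) ∧
      (∀ t, IsOptimalMix w p₁ p₂ K₁ K₂ K₀ t →
        d = singleOptionBound w (mix t p₁ p₂) (mix t K₁ K₂) K₀ ∧
        primalSup (callPayoff (mix t K₁ K₂)) (mix t p₁ p₂) (basketPayoff w K₀) = (d : EReal) ∧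
        dualSup (callPayoff (mix t K₁ K₂)) (mix t p₁ p₂) (basketPayoff w K₀) = (d : EReal)) ∧
      (∑ i, w i * K₂ i ≤ K₀ →
        (∀ t, IsOptimalMix w p₁ p₂ K₁ K₂ K₀ t → t = 1) ∧
        d = ∑ i, w i * p₂ i ∧
        ∃ π : ℕ → Measure (Fin n → ℝ),
          (∀ k, IsFeasible (Sum.elim (callPayoff K₁) (callPayoff K₂)) (Sum.elim p₁ p₂) (π k) ∧
            HasFiniteSupport (π k)) ∧
          Tendsto (fun k => ∫ x, basketPayoff w K₀ x ∂(π k)) atTop (𝓝 d)) ∧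
      (K₀ < ∑ i, w i * K₂ i →
        ∃ π : Measure (Fin n → ℝ),
          IsFeasible (Sum.elim (callPayoff K₁) (callPayoff K₂)) (Sum.elim p₁ p₂) π ∧
          HasFiniteSupport π ∧
          ∫ x, basketPayoff w K₀ x ∂π = d)) := by
  refine ⟨fun p q K _ hp hpq hq => ?_, fun p₁ p₂ K₁ K₂ hK₁ hK hp₂ hp hpK d hd =>
    two_options_per_asset hw K₀ hK₁ hK hp₂ hp hpK hd⟩
  have hmix : ∀ t : Fin n → ℝ, mix t 0 K = fun i => t i * K i := fun t => by
    ext i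
    simp [mix]
  have hpay := forwardPayoff_eq_callPayoff_zero K
  have h := two_options_per_asset (K₁ := 0) (K₂ := K) hw K₀ (fun _ => le_rfl)
    -- Strict positivity of `K i` follows from `p i < q i ≤ p i + K i`.
    (fun i => by simpa using (by linarith [hpq i, hq i] : 0 < K i)) hp hpq
    (fun i => by simpa using hq i) rfl
  simp only [Pi.zero_apply, sub_zero, mul_zero, Finset.sum_const_zero, hmix,
    primalSup_congr hpay, dualSup_congr hpay, isFeasible_congr hpay] at h
  exact h
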